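/- Let $X$ be a metric space and let $\pi : X\times\mathcal B(X)\to[0,1]$ be the transition function (Markov kernel) of a discrete-time Markov chain on $X$, with $n$-step transition functions $\pi^n$. Assume that (a) there exists $z\in X$ such that for every $\varepsilon>0$ there exists $\alpha>0$ with $\liminf_{n\to\infty}\pi^n(x,B(z,\varepsilon))\ge\alpha$ for every $x\in X$, where $B(z,\varepsilon)$ is the open ball; (b) for every bounded continuous $\varphi:X\to\mathbb R$ the family of functions $x\mapsto\int_X\varphi(y)\,\pi^n(x,dy)$, $n\in\mathbb N$, is equicontinuous at every point of $X$. Then there is a unique invariant Borel probability measure $\mu_*$ for $\pi$ (that is, $\int_X\pi(x,\cdot)\,\mu_*(dx)=\mu_*$), and for every compact $K\subset X$ and every bounded continuous $\varphi:X\to\mathbb R$, $$\lim_{n\to\infty}\ \sup_{\mu}\ \left|\left\langle\varphi,\int_X\pi^n(x,\cdot)\,\mu(dx)\right\rangle-\langle\varphi,\mu_*\rangle\right|=0,$$ where $\langle\varphi,\nu\rangle=\int_X\varphi\,d\nu$ and the supremum is over all Borel probability measures $\mu$ supported in $K$, i.e. such that $\operatorname{supp}\mu\subset K$ and $\mu(X\setminus\operatorname{supp}\mu)=0$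 (equivalently, $\mu(K)=1$). In particular, $\pi^n(x,\cdot)$ converges weakly to $\mu_*$, uniformly on compact sets: for every compact $K\subset X$ and every bounded continuous $\varphi$, $\lim_{n\to\infty}\sup_{x\in K}\left|\int_X\varphi(y)\,\pi^n(x,dy)-\langle\varphi,\mu_*\rangle\right|=0$. -/

import Mathlib

open MeasureTheory ProbabilityTheory Filter Topology
open scoped NNReal ENNReal BoundedContinuousFunction

/-- A measure `μ` is supported in `K` if `μ` is concentrated on its topological support `supp μ`
and `supp μ ⊆ K`. For a probability measure and a compact subset `K` of a metric space this says
exactly that `μ K = 1`. The first condition is automatic in separable metric spaces and for tight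
measures; in a general metric space it is part of what "supported in `K`" means. -/
def SupportedIn {X : Type*} [TopologicalSpace X] [MeasurableSpace X] (μ : Measure X)
    (K : Set X) : Prop :=
  μ μ.supportᶜ = 0 ∧ μ.support ⊆ K

/-! Write `P_n φ` for `transition π n φ`. Two independent chains started at `x` and `y` are both in
a small ball around `z` at a common time with probability bounded below. There equicontinuity makes
the oscillation of `P_n φ` small, so the supremum over all pairs of the asymptotic oscillation would
strictly improve on itself unless it is zero (`tendsto_edist_transition`). Hence `P_n φ x - P_n φ z
→ 0`.

It remains to find the limit of `π^n(z, ·)`. Since `X` need be neither complete nor separable,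
tightness is replaced by uniform `σ`-smoothness: if `φ_k` decreases pointwise to 0, then `P_n φ_k z`
is small uniformly in `n` (`uniformly_smooth_transition`). Failure would produce arbitrarily many
blocks of a telescoping series that all keep a fixed mass at one late time, although the series is
bounded. That the radius of equicontinuity is the same for all late blocks follows from Baire's
theorem on the space of subseries. Smoothness yields both convergence of `P_n φ z` and, by a
Daniell-type construction, a limiting measure.

Invariance follows from the Feller property, uniqueness from dominated convergence, and uniformity
on compact sets from equicontinuity. -/

/-! ### Measures from `σ`-smooth functionals. -/

section Daniell

variable {X : Type*} [MetricSpace X]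

/-- The supremum of `l φ` over all bounded continuous `φ` with `0 ≤ φ ≤ 1_U`. -/
noncomputable def openValue (l : (X →ᵇ ℝ) →ₗ[ℝ] ℝ) (U : Set X) : ℝ≥0∞ :=
  ⨆ (φ : X →ᵇ ℝ) (_ : 0 ≤ φ ∧ ∀ x, φ x ≤ U.indicator 1 x), ENNReal.ofReal (l φ)

lemma le_openValue (l : (X →ᵇ ℝ) →ₗ[ℝ] ℝ) {U : Set X} {φ : X →ᵇ ℝ} (h0 : 0 ≤ φ)
    (h1 : ∀ x, φ x ≤ U.indicator 1 x) : ENNReal.ofReal (l φ) ≤ openValue l U :=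
  le_iSup₂_of_le φ ⟨h0, h1⟩ le_rfl

lemma openValue_empty (l : (X →ᵇ ℝ) →ₗ[ℝ] ℝ) : openValue l (∅ : Set X) = 0 := by
  refine le_antisymm (iSup₂_le fun φ hφ => ?_) zero_le
  have : φ = 0 := by
    ext x
    exact le_antisymm (by simpa using hφ.2 x) (hφ.1 x)
  simp [this]

lemma openValue_mono (l : (X →ᵇ ℝ) →ₗ[ℝ] ℝ) {U V : Set X} (h : U ⊆ V) :
    openValue l U ≤ openValue l V :=
  iSup₂_le fun _ hφ => le_openValue l hφ.1 fun x =>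
    (hφ.2 x).trans (Set.indicator_le_indicator_of_subset h (fun _ => zero_le_one) x)

lemma openValue_add_le (l : (X →ᵇ ℝ) →ₗ[ℝ] ℝ) (hpos : ∀ φ, 0 ≤ φ → 0 ≤ l φ) {U V : Set X}
    (h : Disjoint U V) : openValue l U + openValue l V ≤ openValue l (U ∪ V) := by
  have hne (W : Set X) : ∃ φ : X →ᵇ ℝ, 0 ≤ φ ∧ ∀ x, φ x ≤ W.indicator 1 x :=
    ⟨0, le_rfl, fun x => Set.indicator_nonneg (fun _ _ => zero_le_one) x⟩
  refine ENNReal.biSup_add_biSup_le' (hne U) (hne V) fun φ hφ ψ hψ => ?_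
  rw [← ENNReal.ofReal_add (hpos φ hφ.1) (hpos ψ hψ.1), ← map_add]
  refine le_openValue l (add_nonneg hφ.1 hψ.1) fun x => ?_
  rw [Set.indicator_union_of_disjoint h]
  exact add_le_add (hφ.2 x) (hψ.2 x)

/-- Continuous functions increasing in `k` to the indicator of the open set `U`. -/
noncomputable def openApprox (U : Set X) (k : ℕ) : X →ᵇ ℝ :=
  BoundedContinuousFunction.ofNormedAddCommGroup
    (fun x => 1 - (thickenedIndicator (δ := 1 / ((k : ℝ) + 1)) Nat.one_div_pos_of_nat Uᶜ x : ℝ))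
    (by fun_prop) 1 (fun x => by
      have := thickenedIndicator_le_one (δ := 1 / ((k : ℝ) + 1)) Nat.one_div_pos_of_nat Uᶜ x
      have h' : (thickenedIndicator (δ := 1 / ((k : ℝ) + 1)) Nat.one_div_pos_of_nat Uᶜ x : ℝ) ≤ 1 :=
        by exact_mod_cast this
      rw [Real.norm_eq_abs, abs_le]
      constructor
      · linarith
      · simp)

lemma openApprox_apply (U : Set X) (k : ℕ) (x : X) : openApprox U k x =
    1 - (thickenedIndicator (δ := 1 / ((k : ℝ) + 1)) Nat.one_div_pos_of_nat Uᶜ x : ℝ) := rfl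

lemma openApprox_nonneg (U : Set X) (k : ℕ) (x : X) : 0 ≤ openApprox U k x := by
  rw [openApprox_apply, sub_nonneg]
  exact_mod_cast thickenedIndicator_le_one Nat.one_div_pos_of_nat Uᶜ x

lemma openApprox_le (U : Set X) (k : ℕ) (x : X) : openApprox U k x ≤ U.indicator 1 x := by
  rw [openApprox_apply]
  by_cases hx : x ∈ U
  · simp [hx]
  · rw [thickenedIndicator_one _ _ (show x ∈ Uᶜ from hx)]
    simp [hx]

lemma openApprox_mono (U : Set X) (x : X) : Monotone fun k => openApprox U k x := by
  intro j k h
  simp only [openApprox_apply]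
  gcongr 1 - ?_
  exact_mod_cast thickenedIndicator_mono Nat.one_div_pos_of_nat Nat.one_div_pos_of_nat
    (Nat.one_div_le_one_div h) Uᶜ x

lemma openApprox_tendsto {U : Set X} (hU : IsOpen U) {x : X} (hx : x ∈ U) :
    Tendsto (fun k => openApprox U k x) atTop (𝓝 1) := by
  have h := thickenedIndicator_tendsto_indicator_closure
    (δseq := fun k : ℕ => 1 / ((k : ℝ) + 1)) (fun _ => Nat.one_div_pos_of_nat)
    tendsto_one_div_add_atTop_nhds_zero_nat Uᶜ
  rw [hU.isClosed_compl.closure_eq, tendsto_pi_nhds] at h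
  have h2 := (NNReal.tendsto_coe.2 (h x)).const_sub 1
  rw [Set.indicator_of_notMem (by simpa using hx)] at h2
  simp only [NNReal.coe_zero, sub_zero] at h2
  exact h2

/-- This is the only property of `openValue` that needs `σ`-smoothness: a test function below the
union is, up to a vanishing error, dominated by a finite sum of approximants of the pieces. -/
lemma openValue_iUnion_le (l : (X →ᵇ ℝ) →ₗ[ℝ] ℝ) (hpos : ∀ φ, 0 ≤ φ → 0 ≤ l φ)
    (hσ : ∀ φ : ℕ → X →ᵇ ℝ, Antitone φ → (∀ x, Tendsto (fun k => φ k x) atTop (𝓝 0)) →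
      Tendsto (fun k => l (φ k)) atTop (𝓝 0))
    (U : ℕ → Set X) (hU : ∀ i, IsOpen (U i)) :
    openValue l (⋃ i, U i) ≤ ∑' i, openValue l (U i) := by
  have hmono : Monotone l := fun φ ψ h => by
    have := hpos (ψ - φ) (sub_nonneg.2 h)
    rw [map_sub] at this
    linarith
  refine iSup₂_le fun φ hφ => ?_
  -- The index `k` controls both the number of sets and the quality of the approximation, so one
  -- sequence suffices.
  let S : ℕ → X →ᵇ ℝ := fun k => ∑ i ∈ Finset.range k, openApprox (U i) k
  have hS (k : ℕ) (x : X) : S k x = ∑ i ∈ Finset.range k, openApprox (U i) k x := by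
    simp [S]
  have hS0 (k : ℕ) (x : X) : 0 ≤ S k x := by
    rw [hS]
    exact Finset.sum_nonneg fun i _ => openApprox_nonneg _ _ _
  have hSmono (x : X) : Monotone fun k => S k x := by
    intro j k h
    simp only [hS]
    calc ∑ i ∈ Finset.range j, openApprox (U i) j x
        ≤ ∑ i ∈ Finset.range j, openApprox (U i) k x :=
          Finset.sum_le_sum fun i _ => openApprox_mono _ _ h
      _ ≤ _ := Finset.sum_le_sum_of_subset_of_nonneg (Finset.range_mono h)
          fun i _ _ => openApprox_nonneg _ _ _
  -- The part of `φ` not covered by `S k` decreases pointwise to zero, because `φ ≤ 1` on the union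
  -- and `φ = 0` off it.
  have key : Tendsto (fun k => l (φ - φ ⊓ S k)) atTop (𝓝 0) := by
    refine hσ _ (fun j k h x => ?_) fun x => ?_
    · have := hSmono x h
      change φ x - min (φ x) (S k x) ≤ φ x - min (φ x) (S j x)
      gcongr
    · change Tendsto (fun k => φ x - min (φ x) (S k x)) atTop (𝓝 0)
      have hφ0 : 0 ≤ φ x := hφ.1 x
      have hφ1 := hφ.2 x
      by_cases hx : x ∈ ⋃ i, U i
      · obtain ⟨i, hi⟩ := Set.mem_iUnion.1 hx
        have h1 : Tendsto (fun k => 1 - openApprox (U i) k x) atTop (𝓝 0) := by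
          simpa using (openApprox_tendsto (hU i) hi).const_sub 1
        refine tendsto_of_tendsto_of_tendsto_of_le_of_le' tendsto_const_nhds h1
          (Eventually.of_forall fun k => sub_nonneg.2 (min_le_left _ _)) ?_
        filter_upwards [eventually_gt_atTop i] with k hk
        have h2 : openApprox (U i) k x ≤ S k x := by
          rw [hS]
          exact Finset.single_le_sum (f := fun i => openApprox (U i) k x)
            (fun i _ => openApprox_nonneg _ _ _) (Finset.mem_range.2 hk)
        have h3 : openApprox (U i) k x ≤ 1 := (openApprox_le _ _ _).trans (by simp [hi])
        rw [Set.indicator_of_mem hx] at hφ1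
        simp only [Pi.one_apply] at hφ1
        rcases min_cases (φ x) (S k x) with h | h <;> rw [h.1] <;> linarith
      · rw [Set.indicator_of_notMem hx] at hφ1
        have : φ x = 0 := le_antisymm hφ1 hφ0
        simp [this, hS0]
  have key2 : Tendsto (fun k => ENNReal.ofReal (l (φ - φ ⊓ S k)) + ∑' i, openValue l (U i)) atTop
      (𝓝 (∑' i, openValue l (U i))) := by
    simpa using (ENNReal.tendsto_ofReal key).add_const (∑' i, openValue l (U i))
  refine ge_of_tendsto' key2 fun k => ?_
  calc ENNReal.ofReal (l φ) = ENNReal.ofReal (l (φ - φ ⊓ S k) + l (φ ⊓ S k)) := by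
        rw [← map_add, sub_add_cancel]
    _ ≤ ENNReal.ofReal (l (φ - φ ⊓ S k)) + ENNReal.ofReal (l (φ ⊓ S k)) := ENNReal.ofReal_add_le
    _ ≤ _ := by
      gcongr
      calc ENNReal.ofReal (l (φ ⊓ S k)) ≤ ENNReal.ofReal (l (S k)) :=
            ENNReal.ofReal_le_ofReal (hmono inf_le_right)
        _ = ∑ i ∈ Finset.range k, ENNReal.ofReal (l (openApprox (U i) k)) := by
            rw [map_sum, ENNReal.ofReal_sum_of_nonneg]
            exact fun i _ => hpos _ (openApprox_nonneg _ _)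
        _ ≤ ∑ i ∈ Finset.range k, openValue l (U i) := Finset.sum_le_sum fun i _ =>
            le_openValue l (openApprox_nonneg _ _) (openApprox_le _ _)
        _ ≤ _ := ENNReal.sum_le_tsum _

/-- A positive `σ`-smooth linear functional on the bounded continuous functions of a metric space
determines a Borel measure whose values on open sets are given by inner approximation. -/
theorem exists_measure_eq_openValue [MeasurableSpace X] [BorelSpace X]
    (l : (X →ᵇ ℝ) →ₗ[ℝ] ℝ) (hpos : ∀ φ, 0 ≤ φ → 0 ≤ l φ)
    (hσ : ∀ φ : ℕ → X →ᵇ ℝ, Antitone φ → (∀ x, Tendsto (fun k => φ k x) atTop (𝓝 0)) →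
      Tendsto (fun k => l (φ k)) atTop (𝓝 0)) :
    ∃ μ : Measure X, ∀ U, IsOpen U → μ U = openValue l U := by
  let m : OuterMeasure X := inducedOuterMeasure (P := IsOpen) (fun U _ => openValue l U)
    isOpen_empty (openValue_empty l)
  have PU : ∀ ⦃f : ℕ → Set X⦄, (∀ i, IsOpen (f i)) → IsOpen (⋃ i, f i) := fun f => isOpen_iUnion
  have msU : ∀ ⦃f : ℕ → Set X⦄ (_ : ∀ i, IsOpen (f i)),
      openValue l (⋃ i, f i) ≤ ∑' i, openValue l (f i) :=
    fun f hf => openValue_iUnion_le l hpos hσ f hf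
  have hm (U : Set X) (hU : IsOpen U) : m U = openValue l U :=
    inducedOuterMeasure_eq' (P := IsOpen) (m := fun U _ => openValue l U) PU msU
      (fun s t _ _ h => openValue_mono l h) hU
  have hm' (s : Set X) : m s = ⨅ (t : Set X) (_ : IsOpen t) (_ : s ⊆ t), openValue l t :=
    inducedOuterMeasure_eq_iInf (P := IsOpen) (m := fun U _ => openValue l U) PU msU
      (fun s t _ _ h => openValue_mono l h) s
  -- Carathéodory's criterion: additivity on sets at positive distance makes Borel sets measurable.
  -- The `r / 2`-neighbourhoods of the two sets are disjoint, and `openValue` is superadditive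
  -- there.
  have hmet : m.IsMetric := by
    rintro s t ⟨r, hr0, hr⟩
    refine le_antisymm (measure_union_le s t) ?_
    rw [hm' (s ∪ t)]
    refine le_iInf₂ fun W hW => le_iInf fun hsub => ?_
    have hr2 : 0 < r / 2 := ENNReal.half_pos hr0
    let A : Set X := ⋃ x ∈ s, Metric.eball x (r / 2)
    let B : Set X := ⋃ x ∈ t, Metric.eball x (r / 2)
    have hA : IsOpen A := isOpen_biUnion fun _ _ => Metric.isOpen_eball
    have hB : IsOpen B := isOpen_biUnion fun _ _ => Metric.isOpen_eball
    have hsA : s ⊆ W ∩ A := fun x hx => ⟨hsub (Or.inl hx),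
      Set.mem_biUnion hx (Metric.mem_eball_self hr2)⟩
    have htB : t ⊆ W ∩ B := fun x hx => ⟨hsub (Or.inr hx),
      Set.mem_biUnion hx (Metric.mem_eball_self hr2)⟩
    have hAB : Disjoint (W ∩ A) (W ∩ B) := by
      rw [Set.disjoint_left]
      rintro y ⟨-, hyA⟩ ⟨-, hyB⟩
      obtain ⟨a, ha, hya⟩ := Set.mem_iUnion₂.1 hyA
      obtain ⟨b, hb, hyb⟩ := Set.mem_iUnion₂.1 hyB
      have h1 : edist a b < r := by
        calc edist a b ≤ edist y a + edist y b := edist_triangle_left _ _ _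
          _ < r / 2 + r / 2 := ENNReal.add_lt_add hya hyb
          _ = r := ENNReal.add_halves r
      exact absurd (hr a ha b hb) (not_le.2 h1)
    calc m s + m t ≤ m (W ∩ A) + m (W ∩ B) := add_le_add (measure_mono hsA) (measure_mono htB)
      _ = openValue l (W ∩ A) + openValue l (W ∩ B) := by
        rw [hm _ (hW.inter hA), hm _ (hW.inter hB)]
      _ ≤ openValue l (W ∩ A ∪ W ∩ B) := openValue_add_le l hpos hAB
      _ ≤ openValue l W := openValue_mono l (by simp)
  have hle : ‹MeasurableSpace X› ≤ m.caratheodory := by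
    rw [BorelSpace.measurable_eq (α := X)]
    exact hmet.borel_le_caratheodory
  exact ⟨m.toMeasure hle, fun U hU => by rw [toMeasure_apply _ _ hU.measurableSet, hm U hU]⟩

end Daniell

/-! ### Transition operators and the coupling argument. -/

section Transition

variable {X : Type*} [MetricSpace X] [MeasurableSpace X] [BorelSpace X]

instance isMarkovKernel_pow (π : Kernel X X) [IsMarkovKernel π] (n : ℕ) :
    IsMarkovKernel (π ^ n) := by
  induction n with
  | zero => rw [pow_zero]; exact inferInstanceAs (IsMarkovKernel Kernel.id)
  | succ n ih => rw [pow_succ]; exact inferInstanceAs (IsMarkovKernel ((π ^ n) ∘ₖ π))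

/-- The function `x ↦ ∫ φ(y) πⁿ(x, dy)`. -/
noncomputable def transition (π : Kernel X X) (n : ℕ) (φ : X →ᵇ ℝ) (x : X) : ℝ :=
  ∫ y, φ y ∂((π ^ n) x)

variable (π : Kernel X X) [IsMarkovKernel π]

omit [IsMarkovKernel π] in
lemma transition_measurable (n : ℕ) (φ : X →ᵇ ℝ) : Measurable (transition π n φ) :=
  (StronglyMeasurable.integral_kernel (κ := π ^ n) φ.continuous.stronglyMeasurable).measurable

lemma abs_transition_le (n : ℕ) (φ : X →ᵇ ℝ) (x : X) : |transition π n φ x| ≤ ‖φ‖ := by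
  have := φ.norm_integral_le_norm (μ := (π ^ n) x)
  simpa [transition] using this

lemma transition_sub (n : ℕ) (φ ψ : X →ᵇ ℝ) (x : X) :
    transition π n (φ - ψ) x = transition π n φ x - transition π n ψ x := by
  simpa [transition] using integral_sub (φ.integrable ((π ^ n) x)) (ψ.integrable ((π ^ n) x))

lemma transition_mono (n : ℕ) {φ ψ : X →ᵇ ℝ} (h : φ ≤ ψ) (x : X) :
    transition π n φ x ≤ transition π n ψ x :=
  integral_mono (φ.integrable _) (ψ.integrable _) h

lemma transition_integrable (n : ℕ) (φ : X →ᵇ ℝ) (μ : Measure X) [IsFiniteMeasure μ] :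
    Integrable (transition π n φ) μ :=
  Integrable.of_bound (transition_measurable π n φ).aestronglyMeasurable ‖φ‖
    (Eventually.of_forall fun x => abs_transition_le π n φ x)

lemma integral_bind_pow (μ : Measure X) [IsFiniteMeasure μ] (n : ℕ) (φ : X →ᵇ ℝ) :
    ∫ y, φ y ∂(μ.bind ⇑(π ^ n)) = ∫ x, transition π n φ x ∂μ := by
  have h : ((π ^ n) ∘ₖ Kernel.const Unit μ) () = μ.bind ⇑(π ^ n) := by
    rw [Kernel.comp_apply, Kernel.const_apply]
  rw [← h, Kernel.integral_comp (φ.integrable _)]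
  rfl

lemma transition_add (n m : ℕ) (φ : X →ᵇ ℝ) (x : X) :
    transition π (n + m) φ x = ∫ y, transition π n φ y ∂((π ^ m) x) := by
  rw [← integral_bind_pow, transition, Kernel.pow_add, Kernel.comp_apply]

lemma edist_transition_le (n : ℕ) (φ : X →ᵇ ℝ) (x y : X) :
    edist (transition π n φ x) (transition π n φ y) ≤ ENNReal.ofReal (2 * ‖φ‖) := by
  rw [edist_dist, Real.dist_eq]
  refine ENNReal.ofReal_le_ofReal ((abs_sub _ _).trans ?_)
  linarith [abs_transition_le π n φ x, abs_transition_le π n φ y]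

/-- The product measure is the independent coupling of the two chains at time `m`; the Markov
property is applied to each. -/
lemma edist_transition_add_le (n m : ℕ) (φ : X →ᵇ ℝ) (x y : X) :
    edist (transition π (n + m) φ x) (transition π (n + m) φ y) ≤
      ∫⁻ p : X × X, edist (transition π n φ p.1) (transition π n φ p.2)
        ∂(((π ^ m) x).prod ((π ^ m) y)) := by
  have i1 : Integrable (fun p : X × X => transition π n φ p.1)
      (((π ^ m) x).prod ((π ^ m) y)) := (transition_integrable π n φ _).comp_fst _
  have i2 : Integrable (fun p : X × X => transition π n φ p.2)
      (((π ^ m) x).prod ((π ^ m) y)) := (transition_integrable π n φ _).comp_snd _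
  have e1 : transition π (n + m) φ x = ∫ p : X × X, transition π n φ p.1
      ∂(((π ^ m) x).prod ((π ^ m) y)) := by
    rw [transition_add, integral_fun_fst]; simp
  have e2 : transition π (n + m) φ y = ∫ p : X × X, transition π n φ p.2
      ∂(((π ^ m) x).prod ((π ^ m) y)) := by
    rw [transition_add, integral_fun_snd]; simp
  rw [e1, e2, edist_eq_enorm_sub, ← integral_sub i1 i2]
  refine (enorm_integral_le_lintegral_enorm _).trans_eq ?_
  simp_rw [edist_eq_enorm_sub]

omit [BorelSpace X] in
lemma eventually_lt_measure_ball {κ : Kernel X X} {z x : X} {ε : ℝ} {α : ℝ≥0} (hα : 0 < α)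
    (h : (α : ℝ≥0∞) ≤ liminf (fun n : ℕ => (κ ^ n) x (Metric.ball z ε)) atTop) :
    ∀ᶠ n in atTop, (α / 2 : ℝ≥0∞) < (κ ^ n) x (Metric.ball z ε) := by
  refine eventually_lt_of_lt_liminf (lt_of_lt_of_le ?_ h)
  exact ENNReal.half_lt_self (by exact_mod_cast hα.ne') ENNReal.coe_ne_top

/-- One step of the coupling argument: a bound `L` for the asymptotic oscillation improves when
both chains charge a set on which the asymptotic oscillation is at most `δ`. -/
lemma limsup_edist_transition_le (φ : X →ᵇ ℝ) {L δ β : ℝ≥0∞} {B : Set X} (hB : MeasurableSet B)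
    (hδL : δ ≤ L) (hL : L ≠ ∞)
    (hLim : ∀ u v, limsup (fun n => edist (transition π n φ u) (transition π n φ v)) atTop ≤ L)
    (hLimB : ∀ u ∈ B, ∀ v ∈ B,
      limsup (fun n => edist (transition π n φ u) (transition π n φ v)) atTop ≤ δ)
    {x y : X} {m : ℕ} (hx : β ≤ (π ^ m) x B) (hy : β ≤ (π ^ m) y B) :
    limsup (fun n => edist (transition π n φ x) (transition π n φ y)) atTop ≤
      L - (L - δ) * (β * β) := by
  set P := ((π ^ m) x).prod ((π ^ m) y)
  have hBB : MeasurableSet (B ×ˢ B) := hB.prod hB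
  have hPB : β * β ≤ P (B ×ˢ B) := by
    rw [Measure.prod_prod]
    exact mul_le_mul' hx hy
  calc limsup (fun n => edist (transition π n φ x) (transition π n φ y)) atTop
      = limsup (fun n => edist (transition π (n + m) φ x) (transition π (n + m) φ y)) atTop :=
        (limsup_nat_add (fun n => edist (transition π n φ x) (transition π n φ y)) m).symm
    _ ≤ limsup (fun n => ∫⁻ p : X × X, edist (transition π n φ p.1) (transition π n φ p.2) ∂P)
          atTop := limsup_le_limsup (Eventually.of_forall fun n =>
            edist_transition_add_le π n m φ x y)
    _ ≤ ∫⁻ p : X × X, limsup (fun n => edist (transition π n φ p.1) (transition π n φ p.2)) atTop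
          ∂P := by
        -- Reverse Fatou, with a constant dominating function.
        refine limsup_lintegral_le (fun _ => ENNReal.ofReal (2 * ‖φ‖)) (fun n => ?_)
          (fun n => Eventually.of_forall fun p => edist_transition_le π n φ _ _)
          (by
            rw [lintegral_const]
            exact ENNReal.mul_ne_top ENNReal.ofReal_ne_top (measure_ne_top _ _))
        exact ((transition_measurable π n φ).comp measurable_fst).edist
          ((transition_measurable π n φ).comp measurable_snd)
    _ ≤ ∫⁻ p : X × X, (L - (B ×ˢ B).indicator (fun _ => L - δ) p) ∂P := by
        refine lintegral_mono fun p => ?_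
        by_cases hp : p ∈ B ×ˢ B
        · simp only [Set.indicator_of_mem hp]
          rw [ENNReal.sub_sub_cancel hL hδL]
          exact hLimB _ hp.1 _ hp.2
        · simp only [Set.indicator_of_notMem hp, tsub_zero]
          exact hLim _ _
    _ = L - (L - δ) * P (B ×ˢ B) := by
        have h1 : ∫⁻ p, (B ×ˢ B).indicator (fun _ => L - δ) p ∂P = (L - δ) * P (B ×ˢ B) :=
          lintegral_indicator_const hBB _
        rw [lintegral_sub (measurable_const.indicator hBB) (by
            rw [h1]
            exact ENNReal.mul_ne_top (ENNReal.sub_ne_top hL) (measure_ne_top _ _))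
          (Eventually.of_forall fun p => Set.indicator_le' (fun _ _ => tsub_le_self)
            (fun _ _ => zero_le) p), h1]
        simp
    _ ≤ _ := by gcongr

lemma tendsto_edist_transition {z : X} (φ : X →ᵇ ℝ)
    (lower_bound : ∀ ε : ℝ, 0 < ε → ∃ α : ℝ≥0, 0 < α ∧
      ∀ x : X, (α : ℝ≥0∞) ≤ liminf (fun n : ℕ => (π ^ n) x (Metric.ball z ε)) atTop)
    (equicont : EquicontinuousAt (fun n x => transition π n φ x) z) (x y : X) :
    Tendsto (fun n => edist (transition π n φ x) (transition π n φ y)) atTop (𝓝 0) := by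
  set a : X → X → ℝ≥0∞ := fun u v =>
    limsup (fun n => edist (transition π n φ u) (transition π n φ v)) atTop
  set L : ℝ≥0∞ := ⨆ (u) (v), a u v
  have haL (u v : X) : a u v ≤ L := le_iSup₂_of_le u v le_rfl
  have hLtop : L ≠ ∞ := by
    refine ne_top_of_le_ne_top (ENNReal.ofReal_ne_top (r := 2 * ‖φ‖)) (iSup₂_le fun u v => ?_)
    refine (limsup_le_limsup (Eventually.of_forall fun n => edist_transition_le π n φ u v)).trans ?_
    simp
  have hL0 : L = 0 := by
    by_contra hne
    have hLpos : 0 < L := pos_iff_ne_zero.2 hne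
    obtain ⟨δ, hδ0, hδL⟩ := exists_between hLpos
    have hδ2 : 0 < δ / 2 := ENNReal.half_pos hδ0.ne'
    obtain ⟨ε, hε, hball⟩ := Metric.mem_nhds_iff.1
      (equicont _ (edist_mem_uniformity hδ2))
    have hclose : ∀ u ∈ Metric.ball z ε, ∀ v ∈ Metric.ball z ε, a u v ≤ δ := by
      intro u hu v hv
      have (n : ℕ) : edist (transition π n φ u) (transition π n φ v) ≤ δ := by
        refine (edist_triangle_left _ _ (transition π n φ z)).trans ?_
        rw [← ENNReal.add_halves δ]
        exact add_le_add (hball hu n).le (hball hv n).le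
      refine (limsup_le_limsup (Eventually.of_forall this)).trans ?_
      simp
    obtain ⟨α, hα, hlow⟩ := lower_bound ε hε
    set β : ℝ≥0∞ := (α / 2 : ℝ≥0∞)
    have hβ : 0 < β := ENNReal.half_pos (by exact_mod_cast hα.ne')
    -- Since `β` does not depend on the starting points, the improved bound survives the supremum,
    -- even though the meeting time `m` depends on them.
    have hstep : L ≤ L - (L - δ) * (β * β) := by
      refine iSup₂_le fun u v => ?_
      obtain ⟨m, hmu, hmv⟩ := ((eventually_lt_measure_ball hα (hlow u)).and
        (eventually_lt_measure_ball hα (hlow v))).exists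
      exact limsup_edist_transition_le π φ measurableSet_ball hδL.le hLtop haL hclose hmu.le hmv.le
    refine absurd hstep (not_le.2 (ENNReal.sub_lt_self hLtop hne ?_))
    exact mul_ne_zero (tsub_pos_of_lt hδL).ne' (mul_ne_zero hβ.ne' hβ.ne')
  refine tendsto_of_le_liminf_of_limsup_le zero_le ?_
  exact (haL x y).trans hL0.le

end Transition

/-! ### Subseries, Baire category and uniform smoothness. -/

section Selections

/-- If nonnegative continuous functions add up to a bounded continuous function, then so does
every subfamily. -/
lemma exists_hasSum_selection {X : Type*} [TopologicalSpace X] (ψ : ℕ → X →ᵇ ℝ)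
    (hψ : ∀ k x, 0 ≤ ψ k x) (g : X →ᵇ ℝ) (hg : ∀ x, HasSum (fun k => ψ k x) (g x)) :
    ∃ Ψ : (ℕ → Bool) → X →ᵇ ℝ, ∀ s x, HasSum (fun k => if s k then ψ k x else 0) (Ψ s x) := by
  have h0 (s : ℕ → Bool) (k : ℕ) (x : X) : 0 ≤ (if s k then ψ k x else 0) := by
    split_ifs <;> simp [hψ]
  have h1 (s : ℕ → Bool) (k : ℕ) (x : X) : (if s k then ψ k x else 0) ≤ ψ k x := by
    split_ifs <;> simp [hψ]
  have hs (s : ℕ → Bool) (x : X) : Summable (fun k => if s k then ψ k x else 0) :=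
    Summable.of_nonneg_of_le (h0 s · x) (h1 s · x) (hg x).summable
  have hle (s : ℕ → Bool) (x : X) : (∑' k, if s k then ψ k x else 0) ≤ g x :=
    hasSum_le (h1 s · x) (hs s x).hasSum (hg x)
  have htail (s : ℕ → Bool) (x : X) (N : ℕ) :
      |(∑' k, if s k then ψ k x else 0) - ∑ k ∈ Finset.range N, if s k then ψ k x else 0| ≤
        g x - ∑ k ∈ Finset.range N, ψ k x := by
    rw [abs_of_nonneg (sub_nonneg.2 ((hs s x).sum_le_tsum _ fun k _ => h0 s k x))]
    have := sum_le_hasSum (Finset.range N) (fun k _ => sub_nonneg.2 (h1 s k x))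
      ((hg x).sub (hs s x).hasSum)
    rw [Finset.sum_sub_distrib] at this
    linarith
  have hcont (s : ℕ → Bool) : Continuous fun x => ∑' k, if s k then ψ k x else 0 := by
    -- The tail of the full series dominates every subseries tail. It is continuous, so smallness at
    -- `x₀` persists nearby.
    refine continuous_iff_continuousAt.2 fun x₀ =>
      continuousAt_of_locally_uniform_approx_of_continuousAt fun u hu => ?_
    obtain ⟨ε, hε, hεu⟩ := Metric.mem_uniformity_dist.1 hu
    obtain ⟨N, hN⟩ := ((hg x₀).tendsto_sum_nat.const_sub (g x₀)).eventually
      (gt_mem_nhds (show g x₀ - g x₀ < ε by simpa using hε)) |>.exists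
    have hR : Continuous fun x => g x - ∑ k ∈ Finset.range N, ψ k x := by fun_prop
    refine ⟨_, (hR.tendsto x₀).eventually (gt_mem_nhds hN),
      fun x => ∑ k ∈ Finset.range N, if s k then ψ k x else 0, ?_, fun y hy => hεu ?_⟩
    · refine Continuous.continuousAt (continuous_finsetSum _ fun k _ => ?_)
      split_ifs
      · exact (ψ k).continuous
      · exact continuous_const
    · exact (htail s y N).trans_lt hy
  refine ⟨fun s => BoundedContinuousFunction.ofNormedAddCommGroup
    (fun x => ∑' k, if s k then ψ k x else 0) (hcont s) ‖g‖ fun x => ?_,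
    fun s x => (hs s x).hasSum⟩
  rw [Real.norm_of_nonneg (tsum_nonneg (h0 s · x))]
  exact (hle s x).trans ((le_abs_self _).trans (g.norm_coe_le_norm x))

variable {X : Type*} [MetricSpace X] [MeasurableSpace X] [BorelSpace X]
  (π : Kernel X X) [IsMarkovKernel π]

lemma continuous_transition_selection (ψ : ℕ → X →ᵇ ℝ)
    (hψ : ∀ k x, 0 ≤ ψ k x) (g : X →ᵇ ℝ) (hg : ∀ x, HasSum (fun k => ψ k x) (g x))
    (Ψ : (ℕ → Bool) → X →ᵇ ℝ)
    (hΨ : ∀ s x, HasSum (fun k => if s k then ψ k x else 0) (Ψ s x)) (n : ℕ) (x : X) :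
    Continuous fun s => transition π n (Ψ s) x := by
  have h0 (s : ℕ → Bool) (k : ℕ) (x : X) : 0 ≤ (if s k then ψ k x else 0) := by
    split_ifs <;> simp [hψ]
  have h1 (s : ℕ → Bool) (k : ℕ) (x : X) : (if s k then ψ k x else 0) ≤ ψ k x := by
    split_ifs <;> simp [hψ]
  refine continuous_of_dominated (bound := g)
    (fun s => (Ψ s).continuous.aestronglyMeasurable) (fun s => Eventually.of_forall fun y => ?_)
    (g.integrable _) (Eventually.of_forall fun y => ?_)
  · rw [Real.norm_of_nonneg ((hΨ s y).nonneg (h0 s · y))]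
    exact hasSum_le (h1 s · y) (hΨ s y) (hg y)
  · simp_rw [← fun s => (hΨ s y).tsum_eq]
    refine continuous_tsum (u := fun k => ψ k y) (fun k => ?_) (hg y).summable fun k s => ?_
    · exact (continuous_of_discreteTopology (f := fun b : Bool => if b then ψ k y else 0)).comp
        (continuous_apply k)
    · rw [Real.norm_of_nonneg (h0 s k y)]
      exact h1 s k y

/-- If the transition operators are equicontinuous at `z` on every bounded continuous function,
they are eventually jointly equicontinuous at `z` on the terms of a series of nonnegative functions
with bounded continuous sum. -/
lemma eventually_equicontinuous_series {z : X}
    (equicont : ∀ φ : X →ᵇ ℝ, EquicontinuousAt (fun n x => transition π n φ x) z)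
    (ψ : ℕ → X →ᵇ ℝ) (hψ : ∀ k x, 0 ≤ ψ k x) (g : X →ᵇ ℝ)
    (hg : ∀ x, HasSum (fun k => ψ k x) (g x)) {η : ℝ} (hη : 0 < η) :
    ∃ r > 0, ∃ N, ∀ k ≥ N, ∀ n, ∀ x ∈ Metric.ball z r,
      |transition π n (ψ k) x - transition π n (ψ k) z| ≤ η := by
  obtain ⟨Ψ, hΨ⟩ := exists_hasSum_selection ψ hψ g hg
  have hcont := continuous_transition_selection π ψ hψ g hg Ψ hΨ
  -- Baire's theorem on the compact space `ℕ → Bool`: these closed sets cover it, so some `E j` has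
  -- interior.
  let E : ℕ → Set (ℕ → Bool) := fun j => {s | ∀ n, ∀ x ∈ Metric.ball z (1 / ((j : ℝ) + 1)),
    |transition π n (Ψ s) x - transition π n (Ψ s) z| ≤ η / 2}
  have hclosed (j : ℕ) : IsClosed (E j) := by
    simp only [E, Set.ofPred_forall]
    exact isClosed_iInter fun n => isClosed_iInter fun x => isClosed_iInter fun _ =>
      isClosed_le ((hcont n x).sub (hcont n z)).abs continuous_const
  have hunion : ⋃ j, E j = Set.univ := by
    refine Set.eq_univ_of_forall fun s => Set.mem_iUnion.2 ?_
    obtain ⟨r, hr, hball⟩ := Metric.mem_nhds_iff.1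
      (equicont (Ψ s) _ (Metric.dist_mem_uniformity (half_pos hη)))
    obtain ⟨j, hj⟩ := exists_nat_one_div_lt hr
    refine ⟨j, fun n x hx => ?_⟩
    have := hball (Metric.ball_subset_ball hj.le hx) n
    rw [← Real.dist_eq, dist_comm]
    exact le_of_lt this
  obtain ⟨j, s, hs⟩ := nonempty_interior_of_iUnion_of_closed hclosed hunion
  -- In the product topology, changing one far coordinate of an interior point stays in `E j`.
  have hlim (b : Bool) : ∀ᶠ k in atTop, Function.update s k b ∈ E j := by
    have : Tendsto (fun k => Function.update s k b) atTop (𝓝 s) := by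
      refine tendsto_pi_nhds.2 fun i => tendsto_const_nhds.congr' ?_
      filter_upwards [eventually_gt_atTop i] with k hk
      rw [Function.update_of_ne hk.ne]
    exact (this.eventually (isOpen_interior.mem_nhds hs)).mono fun k hk => interior_subset hk
  obtain ⟨N, hN⟩ := eventually_atTop.1 ((hlim true).and (hlim false))
  refine ⟨1 / ((j : ℝ) + 1), Nat.one_div_pos_of_nat, N, fun k hk n x hx => ?_⟩
  have hdiff : ψ k = Ψ (Function.update s k true) - Ψ (Function.update s k false) := by
    ext y
    have h1 := (hΨ (Function.update s k true) y).sub (hΨ (Function.update s k false) y)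
    have h2 := hasSum_single (f := fun i => (if Function.update s k true i then ψ i y else 0) -
      if Function.update s k false i then ψ i y else 0) k fun i hi => by
        simp [Function.update_of_ne hi]
    simpa using h2.unique h1
  obtain ⟨ht, hf⟩ := hN k hk
  have ht := abs_le.1 (ht n x hx)
  have hf := abs_le.1 (hf n x hx)
  rw [hdiff, transition_sub, transition_sub, abs_le]
  constructor <;> linarith [ht.1, ht.2, hf.1, hf.2]

lemma tendsto_transition_of_antitone {φ : ℕ → X →ᵇ ℝ} (hφ : Antitone φ)
    (hlim : ∀ x, Tendsto (fun k => φ k x) atTop (𝓝 0)) (n : ℕ) (x : X) :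
    Tendsto (fun k => transition π n (φ k) x) atTop (𝓝 0) := by
  have hanti (y : X) : Antitone fun k => φ k y := fun i j h => hφ h y
  have := tendsto_integral_of_dominated_convergence (μ := (π ^ n) x) (F := fun k y => φ k y)
    (f := fun _ => 0) (fun y => φ 0 y) (fun k => (φ k).continuous.aestronglyMeasurable)
    ((φ 0).integrable _) (fun k => Eventually.of_forall fun y => ?_) (Eventually.of_forall hlim)
  · simpa [transition] using this
  · rw [Real.norm_of_nonneg ((hanti y).le_of_tendsto (hlim y) k)]
    exact hanti y (Nat.zero_le k)

/-- Wait until the chain is in the ball with probability above `α / 2`, then run the last `n` steps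
from there. The bound thus passes from time `n` to all late times. -/
lemma eventually_le_transition {z : X} (ψ : X →ᵇ ℝ) (hψ : 0 ≤ ψ) {n : ℕ} {r η : ℝ} (hη : 0 ≤ η)
    (h : ∀ x ∈ Metric.ball z r, η ≤ transition π n ψ x) {α : ℝ≥0} (hα : 0 < α)
    (hlow : (α : ℝ≥0∞) ≤ liminf (fun n : ℕ => (π ^ n) z (Metric.ball z r)) atTop) :
    ∀ᶠ t in atTop, η * (α / 2) ≤ transition π t ψ z := by
  obtain ⟨M, hM⟩ := eventually_atTop.1 (eventually_lt_measure_ball hα hlow)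
  filter_upwards [eventually_ge_atTop (n + M)] with t ht
  obtain ⟨m, rfl⟩ := Nat.exists_eq_add_of_le (show n ≤ t by omega)
  have hm := hM m (by omega)
  have hreal : (α / 2 : ℝ) ≤ ((π ^ m) z).real (Metric.ball z r) := by
    have := ENNReal.toReal_mono (measure_ne_top _ _) hm.le
    simpa [Measure.real] using this
  rw [transition_add]
  calc η * (α / 2) ≤ η * ((π ^ m) z).real (Metric.ball z r) := by gcongr
    _ = ∫ y, (Metric.ball z r).indicator (fun _ => η) y ∂((π ^ m) z) := by
      rw [integral_indicator_const _ measurableSet_ball, smul_eq_mul, mul_comm]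
    _ ≤ ∫ y, transition π n ψ y ∂((π ^ m) z) := by
      refine integral_mono ((integrable_const η).indicator measurableSet_ball)
        (transition_integrable π n ψ _) fun y => ?_
      exact Set.indicator_le' (fun y hy => h y hy) (fun y _ => integral_nonneg hψ) y

/-- Under equicontinuity and the lower bound, the laws `πⁿ(z, ·)` are uniformly `σ`-smooth. -/
theorem uniformly_smooth_transition {z : X}
    (lower_bound : ∀ ε : ℝ, 0 < ε → ∃ α : ℝ≥0, 0 < α ∧
      (α : ℝ≥0∞) ≤ liminf (fun n : ℕ => (π ^ n) z (Metric.ball z ε)) atTop)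
    (equicont : ∀ φ : X →ᵇ ℝ, EquicontinuousAt (fun n x => transition π n φ x) z)
    {φ : ℕ → X →ᵇ ℝ} (hφ : Antitone φ) (hlim : ∀ x, Tendsto (fun k => φ k x) atTop (𝓝 0))
    {ε : ℝ} (hε : 0 < ε) : ∃ K, ∀ n, transition π n (φ K) z ≤ ε := by
  by_contra! hcon
  choose n hn using hcon
  have hanti (y : X) : Antitone fun k => φ k y := fun i j h => hφ h y
  have hnonneg (k : ℕ) : 0 ≤ φ k := fun y => (hanti y).le_of_tendsto (hlim y) k
  have hnext (K : ℕ) : ∃ K', K < K' ∧ transition π (n K) (φ K') z < ε / 2 :=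
    ((eventually_gt_atTop K).and ((tendsto_transition_of_antitone π hφ hlim (n K) z).eventually
      (gt_mem_nhds (half_pos hε)))).exists
  choose next hnext_gt hnext_lt using hnext
  let κ : ℕ → ℕ := fun i => next^[i] 0
  have hκ (i : ℕ) : κ (i + 1) = next (κ i) := Function.iterate_succ_apply' _ _ _
  have hκmono : StrictMono κ := strictMono_nat_of_lt_succ fun i => by
    rw [hκ]
    exact hnext_gt _
  -- At time `n (κ i)` the block `ψ i` has mass more than `ε - ε / 2` at `z`; equicontinuity costs
  -- `ε / 4` and leaves `ε / 4` on a common ball.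
  let ψ : ℕ → X →ᵇ ℝ := fun i => φ (κ i) - φ (κ (i + 1))
  have hψ (i : ℕ) : 0 ≤ ψ i := sub_nonneg.2 (hφ (hκmono.monotone i.le_succ))
  have hsum (x : X) : HasSum (fun i => ψ i x) (φ (κ 0) x) := by
    rw [hasSum_iff_tendsto_nat_of_nonneg (f := fun i => ψ i x) fun i => hψ i x]
    have h (m : ℕ) : ∑ i ∈ Finset.range m, ψ i x = φ (κ 0) x - φ (κ m) x :=
      Finset.sum_range_sub' (fun i => φ (κ i) x) m
    simp_rw [h]
    simpa using ((hlim x).comp hκmono.tendsto_atTop).const_sub (φ (κ 0) x)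
  obtain ⟨r, hr, N, hN⟩ := eventually_equicontinuous_series π equicont ψ (fun i x => hψ i x)
    (φ (κ 0)) hsum (η := ε / 4) (by positivity)
  have hball (i : ℕ) (hi : N ≤ i) (x : X) (hx : x ∈ Metric.ball z r) :
      ε / 4 ≤ transition π (n (κ i)) (ψ i) x := by
    have h1 := (abs_le.1 (hN i hi (n (κ i)) x hx)).1
    have h2 : transition π (n (κ i)) (ψ i) z = transition π (n (κ i)) (φ (κ i)) z -
      transition π (n (κ i)) (φ (κ (i + 1))) z := transition_sub _ _ _ _ _
    have h3 := hn (κ i)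
    have h4 := hnext_lt (κ i)
    rw [← hκ] at h4
    linarith
  obtain ⟨α, hα, hlow⟩ := lower_bound r hr
  set c : ℝ := ε / 4 * (α / 2)
  have hcpos : 0 < c := by
    have : (0 : ℝ) < α := hα
    positivity
  -- At a common late time `M` blocks each have mass at least `c`, while their telescoping sum is at
  -- most `‖φ (κ N)‖`.
  obtain ⟨M, hM⟩ := exists_nat_gt (‖φ (κ N)‖ / c)
  have hev : ∀ᶠ t in atTop, ∀ i ∈ Finset.range M, c ≤ transition π t (ψ (N + i)) z :=
    (eventually_all_finset _).2 fun i _ => eventually_le_transition π (ψ (N + i)) (hψ _)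
      (by positivity) (hball (N + i) (by omega)) hα hlow
  obtain ⟨t, ht⟩ := hev.exists
  have h1 : M * c ≤ ∑ i ∈ Finset.range M, transition π t (ψ (N + i)) z := by
    simpa using Finset.card_nsmul_le_sum _ _ _ ht
  have h2 : ∑ i ∈ Finset.range M, transition π t (ψ (N + i)) z =
      transition π t (φ (κ N)) z - transition π t (φ (κ (N + M))) z := by
    refine Eq.trans ?_ (Finset.sum_range_sub' (fun i => transition π t (φ (κ (N + i))) z) M)
    exact Finset.sum_congr rfl fun i _ => transition_sub _ _ _ _ _
  have h3 : 0 ≤ transition π t (φ (κ (N + M))) z := integral_nonneg (hnonneg _)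
  have h4 := (abs_le.1 (abs_transition_le π t (φ (κ N)) z)).2
  rw [div_lt_iff₀ hcpos] at hM
  linarith

end Selections

lemma Equicontinuous.continuous_iSup {X ι : Type*} [TopologicalSpace X] [Nonempty ι]
    {F : ι → X → ℝ} (hF : Equicontinuous F) (hb : ∀ x, BddAbove (Set.range fun i => F i x)) :
    Continuous fun x => ⨆ i, F i x := by
  refine continuous_iff_continuousAt.2 fun x₀ => Metric.tendsto_nhds.2 fun ε hε => ?_
  filter_upwards [hF x₀ _ (Metric.dist_mem_uniformity (half_pos hε))] with x hx
  have hx (i : ι) : |F i x₀ - F i x| < ε / 2 := hx i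
  have h1 : (⨆ i, F i x) ≤ (⨆ i, F i x₀) + ε / 2 := ciSup_le fun i => by
    linarith [(abs_lt.1 (hx i)).1, le_ciSup (hb x₀) i]
  have h2 : (⨆ i, F i x₀) ≤ (⨆ i, F i x) + ε / 2 := ciSup_le fun i => by
    linarith [(abs_lt.1 (hx i)).2, le_ciSup (hb x) i]
  rw [Real.dist_eq, abs_lt]
  constructor <;> linarith

/-! ### Existence of the limit law. -/

section Limit

variable {X : Type*} [MetricSpace X] [MeasurableSpace X] [BorelSpace X]
  (π : Kernel X X) [IsMarkovKernel π]

/-- By the Markov property, `P_{K+k} φ z - P_K φ z` is the mean of `P_K φ - P_K φ z` under `π^k(z,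
·)`. A continuous majorant decreasing to zero in `K` makes this small uniformly in `k`. -/
lemma cauchySeq_transition {z : X}
    (lower_bound : ∀ ε : ℝ, 0 < ε → ∃ α : ℝ≥0, 0 < α ∧
      ∀ x : X, (α : ℝ≥0∞) ≤ liminf (fun n : ℕ => (π ^ n) x (Metric.ball z ε)) atTop)
    (equicont : ∀ φ : X →ᵇ ℝ, Equicontinuous (fun n x => transition π n φ x))
    (φ : X →ᵇ ℝ) : CauchySeq fun n => transition π n φ z := by
  let F : ℕ → X → ℝ := fun m x => |transition π m φ x - transition π m φ z|
  have hF : Equicontinuous F := by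
    intro x₀
    refine Metric.equicontinuousAt_iff_right.2 fun ε hε => ?_
    filter_upwards [Metric.equicontinuousAt_iff_right.1 (equicont φ x₀) ε hε] with x hx m
    refine lt_of_le_of_lt ?_ (hx m)
    rw [Real.dist_eq, Real.dist_eq]
    refine (abs_abs_sub_abs_le_abs_sub _ _).trans_eq ?_
    rw [sub_sub_sub_cancel_right]
  have hFb (m : ℕ) (x : X) : F m x ≤ 2 * ‖φ‖ := by
    refine (abs_sub _ _).trans ?_
    linarith [abs_transition_le π m φ x, abs_transition_le π m φ z]
  have hbdd (k : ℕ) (x : X) : BddAbove (Set.range fun i => F (k + i) x) :=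
    ⟨2 * ‖φ‖, by rintro _ ⟨i, rfl⟩; exact hFb _ x⟩
  have hg0 (k : ℕ) (x : X) : 0 ≤ ⨆ i, F (k + i) x := Real.iSup_nonneg fun i => abs_nonneg _
  -- Taking the supremum over all later times forces monotonicity; equicontinuity keeps it
  -- continuous.
  let g : ℕ → X →ᵇ ℝ := fun k => BoundedContinuousFunction.ofNormedAddCommGroup
    (fun x => ⨆ i, F (k + i) x)
    ((hF.comp fun i => k + i).continuous_iSup (hbdd k)) (2 * ‖φ‖) fun x => by
      rw [Real.norm_of_nonneg (hg0 k x)]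
      exact ciSup_le fun i => hFb _ x
  have hFg (k m : ℕ) (h : k ≤ m) (x : X) : F m x ≤ g k x := by
    obtain ⟨i, rfl⟩ := Nat.exists_eq_add_of_le h
    exact le_ciSup (hbdd k x) i
  have hanti : Antitone g := fun j k h x => ciSup_le fun i => hFg j (k + i) (by omega) x
  have hlim (x : X) : Tendsto (fun k => g k x) atTop (𝓝 0) := by
    have h := tendsto_edist_transition π φ lower_bound (equicont φ z) x z
    refine Metric.tendsto_atTop.2 fun ε hε => ?_
    obtain ⟨K, hK⟩ := Metric.tendsto_atTop.1
      ((ENNReal.tendsto_toReal ENNReal.zero_ne_top).comp h) (ε / 2) (half_pos hε)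
    refine ⟨K, fun k hk => ?_⟩
    rw [Real.dist_eq, sub_zero, abs_of_nonneg (show 0 ≤ g k x from hg0 k x)]
    refine lt_of_le_of_lt (ciSup_le fun i => ?_) (half_lt_self hε)
    have := hK (k + i) (by omega)
    rw [Real.dist_eq, Function.comp_apply, edist_dist, ENNReal.toReal_zero, sub_zero,
      ENNReal.toReal_ofReal dist_nonneg, abs_of_nonneg dist_nonneg, Real.dist_eq] at this
    exact this.le
  refine Metric.cauchySeq_iff'.2 fun ε hε => ?_
  obtain ⟨K, hK⟩ := uniformly_smooth_transition π
    (fun ε hε => let ⟨α, hα, h⟩ := lower_bound ε hε; ⟨α, hα, h z⟩) (fun φ => equicont φ z)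
    hanti hlim (half_pos hε)
  refine ⟨K, fun n hn => ?_⟩
  obtain ⟨k, rfl⟩ := Nat.exists_eq_add_of_le hn
  have hint := transition_integrable π K φ ((π ^ k) z)
  have heq : transition π (K + k) φ z - transition π K φ z =
      ∫ y, (transition π K φ y - transition π K φ z) ∂((π ^ k) z) := by
    rw [integral_sub hint (integrable_const _), transition_add]
    simp
  rw [Real.dist_eq, heq]
  calc |∫ y, (transition π K φ y - transition π K φ z) ∂((π ^ k) z)|
      ≤ ∫ y, F K y ∂((π ^ k) z) := abs_integral_le_integral_abs
    _ ≤ ∫ y, g K y ∂((π ^ k) z) := integral_mono (hint.sub (integrable_const _)).abs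
        ((g K).integrable _) fun y => hFg K K le_rfl y
    _ ≤ ε / 2 := hK k
    _ < ε := half_lt_self hε

/-- A sequence of Borel probability measures that converges against every bounded continuous
function and is uniformly `σ`-smooth converges weakly to a Borel probability measure. -/
theorem exists_tendsto_of_cauchySeq_of_smooth (μ : ℕ → ProbabilityMeasure X)
    (hμ : ∀ φ : X →ᵇ ℝ, CauchySeq fun n => ∫ x, φ x ∂(μ n : Measure X))
    (hσ : ∀ φ : ℕ → X →ᵇ ℝ, Antitone φ → (∀ x, Tendsto (fun k => φ k x) atTop (𝓝 0)) →
      ∀ ε : ℝ, 0 < ε → ∃ K, ∀ n, ∫ x, φ K x ∂(μ n : Measure X) ≤ ε) :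
    ∃ ν : ProbabilityMeasure X, Tendsto μ atTop (𝓝 ν) := by
  choose L hL using fun φ => cauchySeq_tendsto_of_complete (hμ φ)
  let l : (X →ᵇ ℝ) →ₗ[ℝ] ℝ :=
    { toFun := L
      map_add' := fun φ ψ => tendsto_nhds_unique (hL (φ + ψ)) <|
        ((hL φ).add (hL ψ)).congr fun n =>
          (integral_add (φ.integrable _) (ψ.integrable _)).symm
      map_smul' := fun c φ => tendsto_nhds_unique (hL (c • φ)) <|
        ((hL φ).const_smul c).congr fun n => (integral_smul c _).symm }
  have hl (φ : X →ᵇ ℝ) : Tendsto (fun n => ∫ x, φ x ∂(μ n : Measure X)) atTop (𝓝 (l φ)) := hL φ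
  have hpos (φ : X →ᵇ ℝ) (h : 0 ≤ φ) : 0 ≤ l φ := ge_of_tendsto' (hl φ) fun n => integral_nonneg h
  have hsmooth (φ : ℕ → X →ᵇ ℝ) (hφ : Antitone φ)
      (hlim : ∀ x, Tendsto (fun k => φ k x) atTop (𝓝 0)) :
      Tendsto (fun k => l (φ k)) atTop (𝓝 0) := by
    have hanti (y : X) : Antitone fun k => φ k y := fun i j h => hφ h y
    refine Metric.tendsto_atTop.2 fun ε hε => ?_
    obtain ⟨K, hK⟩ := hσ φ hφ hlim (ε / 2) (half_pos hε)
    refine ⟨K, fun k hk => ?_⟩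
    have h0 : 0 ≤ l (φ k) := hpos _ fun y => (hanti y).le_of_tendsto (hlim y) k
    rw [Real.dist_eq, sub_zero, abs_of_nonneg h0]
    refine lt_of_le_of_lt (le_of_tendsto' (hl (φ k)) fun n => ?_) (half_lt_self hε)
    exact (integral_mono ((φ k).integrable _) ((φ K).integrable _) (hφ hk)).trans (hK n)
  obtain ⟨ν, hν⟩ := exists_measure_eq_openValue l hpos hsmooth
  -- The open-set half of the portmanteau theorem, which with total mass one gives weak convergence.
  have hopen (U : Set X) (hU : IsOpen U) :
      ν U ≤ liminf (fun n => (μ n : Measure X) U) atTop := by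
    rw [hν U hU]
    refine iSup₂_le fun φ hφ => ?_
    rw [← (ENNReal.tendsto_ofReal (hl φ)).liminf_eq]
    refine liminf_le_liminf (Eventually.of_forall fun n => ?_)
    rw [ENNReal.ofReal_le_iff_le_toReal (measure_ne_top _ _)]
    calc ∫ x, φ x ∂(μ n : Measure X) ≤ ∫ x, U.indicator 1 x ∂(μ n : Measure X) :=
          integral_mono (φ.integrable _)
            ((integrable_const (1 : ℝ)).indicator hU.measurableSet) hφ.2
      _ = _ := integral_indicator_one hU.measurableSet
  have huniv : ν Set.univ = 1 := by
    refine le_antisymm ((hopen _ isOpen_univ).trans (by simp)) ?_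
    have h1 : l (BoundedContinuousFunction.const X 1) = 1 :=
      tendsto_nhds_unique (hl _) (by simp)
    rw [hν _ isOpen_univ, ← ENNReal.ofReal_one, ← h1]
    exact le_openValue l (fun x => zero_le_one) fun x => by simp
  exact ⟨⟨ν, ⟨huniv⟩⟩, tendsto_of_forall_isOpen_le_liminf' hopen⟩

end Limit

/-! ### Invariance, uniqueness and uniform convergence. -/

theorem theorem4p5 {X : Type*} [MetricSpace X] [MeasurableSpace X] [BorelSpace X]
    (π : Kernel X X) [IsMarkovKernel π]
    (lower_bound : ∃ z : X, ∀ ε : ℝ, 0 < ε → ∃ α : ℝ≥0, 0 < α ∧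
      ∀ x : X, (α : ℝ≥0∞) ≤ liminf (fun n : ℕ => (π ^ n) x (Metric.ball z ε)) atTop)
    (equicont : ∀ φ : X →ᵇ ℝ,
      Equicontinuous (fun (n : ℕ) (x : X) => ∫ y, φ y ∂((π ^ n) x))) :
    ∃ μs : ProbabilityMeasure X,
      (Kernel.Invariant π (μs : Measure X) ∧
        ∀ ν : ProbabilityMeasure X, Kernel.Invariant π (ν : Measure X) → ν = μs) ∧
      ∀ K : Set X, IsCompact K → ∀ φ : X →ᵇ ℝ,
        TendstoUniformlyOn
          (fun (n : ℕ) (μ : ProbabilityMeasure X) =>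
            ∫ y, φ y ∂((μ : Measure X).bind ⇑(π ^ n)))
          (fun _ => ∫ y, φ y ∂(μs : Measure X)) atTop
          {μ : ProbabilityMeasure X | SupportedIn (μ : Measure X) K} ∧
        TendstoUniformlyOn
          (fun (n : ℕ) (x : X) => ∫ y, φ y ∂((π ^ n) x))
          (fun _ => ∫ y, φ y ∂(μs : Measure X)) atTop K := by
  obtain ⟨z, hz⟩ := lower_bound
  have equicont (φ : X →ᵇ ℝ) : Equicontinuous fun n x => transition π n φ x := equicont φ
  obtain ⟨μs, hμs⟩ := exists_tendsto_of_cauchySeq_of_smooth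
    (fun n => (⟨(π ^ n) z, inferInstance⟩ : ProbabilityMeasure X))
    (cauchySeq_transition π hz equicont) fun φ hφ hlim ε hε =>
      uniformly_smooth_transition π
        (fun ε hε => let ⟨α, hα, h⟩ := hz ε hε; ⟨α, hα, h z⟩) (fun φ => equicont φ z) hφ hlim hε
  have hconvz (φ : X →ᵇ ℝ) : Tendsto (fun n => transition π n φ z) atTop
      (𝓝 (∫ y, φ y ∂(μs : Measure X))) :=
    ProbabilityMeasure.tendsto_iff_forall_integral_tendsto.1 hμs φ
  have hconv (φ : X →ᵇ ℝ) (x : X) : Tendsto (fun n => transition π n φ x) atTop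
      (𝓝 (∫ y, φ y ∂(μs : Measure X))) :=
    (tendsto_iff_of_dist (by
      have h := tendsto_edist_transition π φ hz (equicont φ z) z x
      simpa [edist_dist, Function.comp_def] using
        (ENNReal.tendsto_toReal ENNReal.zero_ne_top).comp h)).1 (hconvz φ)
  refine ⟨μs, ⟨?_, fun ν hν => ?_⟩, fun K hK φ => ?_⟩
  · refine ext_of_forall_integral_eq_of_IsFiniteMeasure fun φ => ?_
    -- Equicontinuity makes `P_1 φ` continuous, so it is itself an admissible test function.
    let ψ : X →ᵇ ℝ := BoundedContinuousFunction.ofNormedAddCommGroup (transition π 1 φ)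
      ((equicont φ).continuous 1) ‖φ‖ (abs_transition_le π 1 φ)
    have h1 := integral_bind_pow π (μs : Measure X) 1 φ
    rw [pow_one] at h1
    rw [h1]
    refine tendsto_nhds_unique (hconvz ψ) ?_
    refine ((tendsto_add_atTop_iff_nat 1).2 (hconvz φ)).congr fun n => ?_
    rw [add_comm, transition_add]
    rfl
  · refine Subtype.ext (ext_of_forall_integral_eq_of_IsFiniteMeasure
      (μ := (ν : Measure X)) (ν := (μs : Measure X)) fun φ => ?_)
    have hinv (n : ℕ) : Kernel.Invariant (π ^ n) (ν : Measure X) := by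
      induction n with
      | zero => exact Measure.bind_dirac
      | succ n ih =>
        rw [pow_succ]
        exact ih.comp hν
    have hdom : Tendsto (fun n => ∫ x, transition π n φ x ∂(ν : Measure X)) atTop
        (𝓝 (∫ _, (∫ y, φ y ∂(μs : Measure X)) ∂(ν : Measure X))) :=
      tendsto_integral_of_dominated_convergence (fun _ => ‖φ‖)
        (fun n => (transition_measurable π n φ).aestronglyMeasurable) (integrable_const _)
        (fun n => Eventually.of_forall fun x => abs_transition_le π n φ x)
        (Eventually.of_forall fun x => hconv φ x)
    simp_rw [← integral_bind_pow, fun n => (hinv n).def] at hdom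
    simpa using tendsto_nhds_unique tendsto_const_nhds hdom
  · have hunif : TendstoUniformlyOn (fun n x => transition π n φ x)
        (fun _ => ∫ y, φ y ∂(μs : Measure X)) atTop K := by
      -- For an equicontinuous family, pointwise convergence on a compact set is uniform.
      have := (EquicontinuousOn.tendsto_uniformOnFun_iff_pi' (𝔖 := {K}) (by simpa using hK)
        (F := fun n x => transition π n φ x) (fun _ _ => (equicont φ).equicontinuousOn _) atTop
        (fun _ => ∫ y, φ y ∂(μs : Measure X))).2 (tendsto_pi_nhds.2 fun x => hconv φ x)
      exact UniformOnFun.tendsto_iff_tendstoUniformlyOn.1 this K rfl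
    refine ⟨?_, hunif⟩
    rw [Metric.tendstoUniformlyOn_iff] at hunif ⊢
    intro ε hε
    filter_upwards [hunif (ε / 2) (half_pos hε)] with n hn μ hμ
    have hae : ∀ᵐ x ∂(μ : Measure X), x ∈ K :=
      measure_mono_null (Set.compl_subset_compl.2 hμ.2) hμ.1
    have hint := transition_integrable π n φ (μ : Measure X)
    have heq : (∫ y, φ y ∂(μs : Measure X)) - ∫ x, transition π n φ x ∂(μ : Measure X) =
        ∫ x, ((∫ y, φ y ∂(μs : Measure X)) - transition π n φ x) ∂(μ : Measure X) := by
      rw [integral_sub (integrable_const _) hint]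
      simp
    rw [integral_bind_pow, Real.dist_eq, heq]
    refine lt_of_le_of_lt ?_ (half_lt_self hε)
    have := norm_integral_le_of_norm_le_const (μ := (μ : Measure X)) (C := ε / 2)
      (f := fun x => (∫ y, φ y ∂(μs : Measure X)) - transition π n φ x)
      (hae.mono fun x hx => (hn x hx).le)
    simpa using this
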